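/- Let $G$ be a finite group. For an integer $m$ coprime to $|G|$, let $\left(\frac{m}{G}\right)_{el}\in\{1,-1\}$ be the sign of the permutation $g\mapsto g^m$ of the set $G$. Let $f_2(G)=\{g\in G: g^2=1\}$, let $n_2(G)$ be the number of Sylow $2$-subgroups of $G$, let $\epsilon(G)=1$ if $|G|=2n_2(G)$ and $\epsilon(G)=0$ otherwise, and define the integer $$d_G=(-1)^{\frac{|G|-|f_2(G)|}{2}}\,\frac{|G|^{|f_2(G)|}}{n_2(G)^{\epsilon(G)}}.$$ Suppose that either $G$ is isomorphic to the direct product of a group of odd order and a $2$-group (either factor may be trivial), or $|G|=2n$ with $n$ odd and every element of $G$ of even order is an involution (has order $2$). Then $$\left(\frac{m}{G}\right)_{el}=\left(\frac{d_G}{m}\right)$$ for every integer $m$ with $\gcd(m,|G|)=1$. Here $\left(\frac{n}{a}\right)$, for $n,a\in\mathbb{Z}$, is the Kronecker symbol: it is multiplicative in $a$, it is the Legendre symbol when $a$ is an odd prime, $\left(\frac{n}{2}\right)$ is $0$ for even $n$, $1$ for $n\equiv 1,7\pmod 8$ and $-1$ for $n\equiv 3,5\pmod 8$, $\left(\frac{n}{-1}\right)$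 is $1$ for $n\ge 0$ and $-1$ for $n<0$, and $\left(\frac{n}{0}\right)$ is $1$ for $n=1$ and $0$ for $n\neq 1$. -/

import Mathlib

/-- The Kronecker symbol `(n / 2)`: `0` for even `n`, `1` for `n ≡ 1, 7 (mod 8)`, and `-1` for
`n ≡ 3, 5 (mod 8)`. -/
def kroneckerTwo (n : ℤ) : ℤ :=
  if n % 2 = 0 then 0 else if n % 8 = 1 ∨ n % 8 = 7 then 1 else -1

/-- The Kronecker symbol `(n / -1)`: `1` for `n ≥ 0` and `-1` for `n < 0`. -/
def kroneckerNegOne (n : ℤ) : ℤ := if n < 0 then -1 else 1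

/-- The Kronecker symbol `(n / a)` of two integers. For `a ≠ 0`, write `a = ± 2 ^ k * b` with `b`
odd and positive; then `(n / a)` is `(n / ± 1) * (n / 2) ^ k` times the Jacobi symbol `(n / b)`,
that is, the product of the Legendre symbols over the prime factors of `b` with multiplicity.
For `a = 0` it is `1` if `n = 1` and `0` otherwise. -/
def kroneckerSym (n a : ℤ) : ℤ :=
  if a = 0 then (if n = 1 then 1 else 0)
  else (if a < 0 then kroneckerNegOne n else 1)
    * kroneckerTwo n ^ (a.natAbs.factorization 2)
    * jacobiSym n (a.natAbs / 2 ^ (a.natAbs.factorization 2))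

/-- The set `f_k(G)` of the elements `g` of `G` with `g ^ k = 1`. -/
def powEqOne (G : Type*) [Group G] (k : ℕ) : Set G := {g | g ^ k = 1}

/-- The number `n₂(G)` of Sylow `2`-subgroups of `G`. -/
noncomputable def numSylowTwo (G : Type*) [Group G] : ℕ := Nat.card (Sylow 2 G)

/-- `ε(G)` is `1` if `|G| = 2 n₂(G)` and `0` otherwise. -/
noncomputable def epsGroup (G : Type*) [Group G] : ℕ :=
  if Nat.card G = 2 * numSylowTwo G then 1 else 0

/-- The integer `d_G = (-1) ^ ((|G| - |f₂(G)|) / 2) * |G| ^ |f₂(G)| / n₂(G) ^ ε(G)`. For a finite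
group both divisions are exact (`card_sub_card_powEqOne_even`, `numSylowTwo_pow_dvd`) and the
subtraction does not truncate, because `f₂(G)` is a subset of `G`. -/
noncomputable def dGroup (G : Type*) [Group G] : ℤ :=
  (-1) ^ ((Nat.card G - Nat.card (powEqOne G 2)) / 2) *
    ((Nat.card G ^ Nat.card (powEqOne G 2) / numSylowTwo G ^ epsGroup G : ℕ) : ℤ)

theorem card_sub_card_powEqOne_even (G : Type*) [Group G] [Finite G] :
    2 ∣ Nat.card G - Nat.card (powEqOne G 2) := by
  classical
  have := Fintype.ofFinite G
  let f : Function.End G := fun g : G => g⁻¹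
  have h2 : f ^ 2 ^ 1 = 1 := by
    rw [pow_one, pow_two]
    exact funext fun g => inv_inv g
  have h := Equiv.Perm.card_fixedPoints_modEq (p := 2) h2
  have hs : powEqOne G 2 = Function.fixedPoints f := by
    ext g
    change g ^ 2 = 1 ↔ g⁻¹ = g
    rw [pow_two, inv_eq_iff_mul_eq_one]
  rw [hs, Nat.card_eq_fintype_card, Nat.card_eq_fintype_card]
  exact (Nat.modEq_iff_dvd' (Fintype.card_subtype_le _)).1 h.symm

theorem numSylowTwo_pow_dvd (G : Type*) [Group G] [Finite G] :
    numSylowTwo G ^ epsGroup G ∣ Nat.card G ^ Nat.card (powEqOne G 2) := by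
  have : Nonempty (powEqOne G 2) := ⟨⟨1, by simp [powEqOne]⟩⟩
  have h0 : Nat.card (powEqOne G 2) ≠ 0 := Nat.card_pos.ne'
  unfold epsGroup
  split_ifs with h
  · rw [pow_one]
    exact (Dvd.intro_left 2 h.symm).trans (dvd_pow_self _ h0)
  · simp

theorem zpow_bijective_of_isCoprime (G : Type*) [Group G] [Finite G] (m : ℤ)
    (hm : IsCoprime m (Nat.card G : ℤ)) : Function.Bijective (fun g : G => g ^ m) := by
  rw [← Finite.injective_iff_bijective]
  obtain ⟨a, b, hab⟩ := hm
  have key : ∀ g : G, (g ^ m) ^ a = g := fun g => by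
    rw [← zpow_mul]
    calc g ^ (m * a) = g ^ (m * a) * (g ^ ((Nat.card G : ℤ))) ^ b := by simp
      _ = g ^ (a * m + b * (Nat.card G : ℤ)) := by
        rw [← zpow_mul, ← zpow_add]; congr 1; ring
      _ = g := by rw [hab, zpow_one]
  intro g h hgh
  rw [← key g, ← key h]
  exact congrArg (· ^ a) hgh

/-- The permutation `g ↦ g ^ m` of a finite group `G`, for `m` coprime to `|G|`. -/
noncomputable def powPerm (G : Type*) [Group G] [Finite G] (m : ℤ)
    (hm : IsCoprime m (Nat.card G : ℤ)) : Equiv.Perm G :=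
  Equiv.ofBijective (fun g : G => g ^ m) (zpow_bijective_of_isCoprime G m hm)

/-- `G` is (isomorphic to) the direct product of a group of odd order and a `2`-group. -/
def IsOddTimesTwoGroup.{u} (G : Type u) [Group G] : Prop :=
  ∃ (K H : Type u) (_ : Group K) (_ : Group H),
    Odd (Nat.card K) ∧ IsPGroup 2 H ∧ Nonempty (G ≃* K × H)

/-- `G` has order `2 n` with `n` odd, and all elements of `G` of even order are involutions. -/
def IsTwiceOddWithInvolutions (G : Type*) [Group G] : Prop :=
  (∃ n : ℕ, Odd n ∧ Nat.card G = 2 * n) ∧ ∀ g : G, Even (orderOf g) → orderOf g = 2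

/-!
For odd `|G|`, the sign of `g ↦ g ^ m` is first transferred to the conjugacy classes. Gauss's lemma
computes the sign of a permutation commuting with an involution from representatives of the pairs
of the involution; inversion moves every nontrivial element and every nontrivial class, and all
classes have odd size, so both permutations have the same sign. By Dirichlet's theorem `m` may be
taken to be an odd prime `q`. Over an algebraic closure of `𝔽_q` the Frobenius permutes the columns
of the character table as `g ↦ g ^ q` permutes the classes, hence multiplies its determinant by the
sign in question. By the second orthogonality relation the square of this determinant is, up to the
sign of inversion, the product of the orders of the centralizers, which is `|G|` up to squares
because a class and its inverse have centralizers of the same order. Quadratic reciprocity turns the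
resulting Legendre symbol into the Jacobi symbol `(m / |G|)`.

If `G` is the product of an odd group and a nontrivial `2`-group, an `m ≡ 1 (mod 4)` acts evenly
on the `2`-group, since a cycle stable under inversion consists of a single involution or of the
identity, and hence on `G`, where the action on the odd factor is repeated an even number of times;
only the sign of inversion remains. In the twice odd case all elements outside a subgroup of index
`2` and odd order are fixed, which reduces the claim to that subgroup.
-/

open Polynomial Finset Equiv Equiv.Perm
open scoped Matrix

section Frobenius

variable {R n : Type*} [CommRing R] [Fintype n] [DecidableEq n] (p : ℕ) [Fact p.Prime] [CharP R p]

theorem charpoly_pow_char (M : Matrix n n R) :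
    (M ^ p).charpoly = M.charpoly.map (frobenius R p) := by
  cases isEmpty_or_nonempty n
  · simp [Matrix.charpoly]
  have hmat : (expand R p : R[X] →+* R[X]).mapMatrix (M ^ p).charmatrix = M.charmatrix ^ p := by
    apply matPolyEquiv.injective
    rw [map_pow, matPolyEquiv_eq_X_pow_sub_C, Matrix.matPolyEquiv_charmatrix,
      sub_pow_char_of_commute _ (C M).commute_X, C_pow]
  apply expand_injective (Fact.out : p.Prime).pos
  calc expand R p (M ^ p).charpoly = M.charmatrix.det ^ p := by
        rw [← Matrix.det_pow, ← hmat, ← RingHom.map_det]; rfl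
    _ = expand R p (M.charpoly.map (frobenius R p)) := by
        rw [← map_expand, map_frobenius_expand]; rfl

theorem trace_pow_char (M : Matrix n n R) : (M ^ p).trace = M.trace ^ p := by
  cases isEmpty_or_nonempty n
  · simp [Matrix.trace, (Fact.out : p.Prime).ne_zero]
  · rw [Matrix.trace_eq_neg_charpoly_coeff, Matrix.trace_eq_neg_charpoly_coeff,
      charpoly_pow_char p, coeff_map, ← map_neg, frobenius_def]

end Frobenius

theorem trace_mulLeftRight_pi_matrix {R ι : Type*} [CommRing R] [Fintype ι] {n : ι → Type*}
    [∀ i, Fintype (n i)] (a b : ∀ i, Matrix (n i) (n i) R) :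
    LinearMap.trace R _ (LinearMap.mulLeftRight R (a, b)) = ∑ i, (a i).trace * (b i).trace := by
  classical
  rw [LinearMap.trace_eq_matrix_trace R (Pi.basis fun i => Matrix.stdBasis R (n i) (n i))]
  have hrepr (i : ι) (X : Matrix (n i) (n i) R) (j k : n i) :
      (Matrix.stdBasis R (n i) (n i)).repr X (j, k) = X j k := rfl
  simp only [Matrix.trace, LinearMap.toMatrix_apply, Matrix.diag_apply, Fintype.sum_sigma,
    Fintype.sum_prod_type, Finset.sum_mul_sum, Pi.basis_repr, Pi.basis_apply, hrepr,
    LinearMap.mulLeftRight_apply, Pi.mul_apply, Pi.single_eq_same, Matrix.stdBasis_eq_single]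
  simp [Matrix.mul_apply, Matrix.single_apply, ite_and]

theorem trace_mulLeftRight_of {R G : Type*} [CommRing R] [Group G] [Finite G] (g h : G) :
    LinearMap.trace R (MonoidAlgebra R G) (LinearMap.mulLeftRight R
      (MonoidAlgebra.of R G g, MonoidAlgebra.of R G h)) = Nat.card {x // g * x * h = x} := by
  classical
  have := Fintype.ofFinite G
  rw [LinearMap.trace_eq_matrix_trace R (MonoidAlgebra.basis G R)]
  have hrepr (a : MonoidAlgebra R G) (x : G) :
      (MonoidAlgebra.basis G R).repr a x = a.coeff x := rfl
  simp [Matrix.trace, LinearMap.toMatrix_apply, hrepr, Finsupp.single_apply, Fintype.card_subtype]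

theorem sign_eq_legendreSym_of_det_sq {K n : Type*} [Field K] [Fintype n] [DecidableEq n] {q : ℕ}
    [Fact q.Prime] [CharP K q] (hq : q ≠ 2) (M : Matrix n n K) (σ : Perm n)
    (hM : ∀ i j, M i j ^ q = M i (σ j)) {D : ℤ} (hD : M.det ^ 2 = D) (hD0 : (D : K) ≠ 0) :
    (sign σ : ℤ) = legendreSym q D := by
  have hdet0 : M.det ≠ 0 := by
    rintro h
    exact hD0 (by rw [← hD, h, zero_pow two_ne_zero])
  have hdet : M.det ^ q = ((sign σ : ℤ) : K) * M.det := by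
    rw [← Matrix.det_permute', ← frobenius_def, RingHom.map_det]
    congr 1
    ext i j
    exact hM i j
  have hpow : M.det ^ (q - 1) = ((sign σ : ℤ) : K) := by
    apply mul_right_cancel₀ hdet0
    rw [← hdet, ← pow_succ, Nat.sub_add_cancel (Fact.out : q.Prime).one_le]
  have hcast : ((legendreSym q D : ℤ) : K) = ((sign σ : ℤ) : K) := by
    let := ZMod.algebra K q
    have h := congrArg (algebraMap (ZMod q) K) (legendreSym.eq_pow q D)
    have hhalf : 2 * (q / 2) = q - 1 := by
      have := (Fact.out : q.Prime).eq_two_or_odd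
      lia
    rwa [map_intCast, map_pow, map_intCast, ← hD, ← pow_mul, hhalf, hpow] at h
  have hchar : ringChar K ≠ 2 := by rwa [ringChar.eq K q]
  refine (Int.cast_injOn_of_ringChar_ne_two hchar ?_ ?_ hcast).symm
  · rw [jacobiSym.legendreSym.to_jacobiSym]
    exact jacobiSym.trichotomy D q
  · rcases Int.units_eq_one_or (sign σ) with h | h <;> simp [h]

section ConjClasses

variable {G : Type*} [Group G]

theorem isConj_zpow {x y : G} (h : IsConj x y) (m : ℤ) : IsConj (x ^ m) (y ^ m) := by
  obtain ⟨c, rfl⟩ := isConj_iff.1 h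
  exact isConj_iff.2 ⟨c, by rw [conj_zpow]⟩

/-- The map on conjugacy classes induced by `g ↦ g ^ m`. -/
def zpowConjClasses (m : ℤ) : ConjClasses G → ConjClasses G :=
  Quotient.map (· ^ m) fun _ _ h => isConj_zpow h m

@[simp]
theorem zpowConjClasses_mk (m : ℤ) (g : G) :
    zpowConjClasses m (ConjClasses.mk g) = ConjClasses.mk (g ^ m) := rfl

/-- The permutation of the conjugacy classes induced by `g ↦ g ^ m`, for `m` coprime to `|G|`. -/
noncomputable def powPermConjClasses (G : Type*) [Group G] [Finite G] (m : ℤ)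
    (hm : IsCoprime m (Nat.card G : ℤ)) : Perm (ConjClasses G) :=
  Equiv.ofBijective (zpowConjClasses m) <| Finite.surjective_iff_bijective.1 fun c => by
    obtain ⟨g, rfl⟩ := ConjClasses.mk_surjective c
    obtain ⟨h, rfl⟩ := (zpow_bijective_of_isCoprime G m hm).2 g
    exact ⟨ConjClasses.mk h, rfl⟩

theorem zpowConjClasses_neg_one_involutive :
    Function.Involutive (zpowConjClasses (-1) : ConjClasses G → ConjClasses G) :=
  ConjClasses.mk_surjective.forall.2 fun g => by simp

theorem card_centralizer_congr {g h : G} (hgh : IsConj g h) :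
    Nat.card (Subgroup.centralizer {g}) = Nat.card (Subgroup.centralizer {h}) := by
  obtain ⟨c, rfl⟩ := isConj_iff.1 hgh
  refine Nat.card_congr ((MulAut.conj c).toEquiv.subtypeEquiv fun x => ?_)
  simp only [Subgroup.mem_centralizer_singleton_iff, MulEquiv.toEquiv_eq_coe,
    EquivLike.coe_coe, ← MulAut.conj_apply, ← map_mul, (MulAut.conj c).injective.eq_iff]

/-- The order of the centralizer of any element of a conjugacy class. -/
noncomputable def centralizerCard : ConjClasses G → ℕ :=
  Quotient.lift (fun g => Nat.card (Subgroup.centralizer {g})) fun _ _ => card_centralizer_congr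

theorem centralizerCard_mk (g : G) :
    centralizerCard (ConjClasses.mk g) = Nat.card (Subgroup.centralizer {g}) := rfl

theorem centralizerCard_one : centralizerCard (1 : ConjClasses G) = Nat.card G := by
  rw [ConjClasses.one_eq_mk_one, centralizerCard_mk,
    Subgroup.centralizer_eq_top_iff_subset.2 (by simp), Subgroup.card_top]

theorem centralizerCard_cast_ne_zero {R : Type*} [Semiring R] (hG : (Nat.card G : R) ≠ 0)
    (c : ConjClasses G) : (centralizerCard c : R) ≠ 0 := by
  obtain ⟨g, rfl⟩ := ConjClasses.mk_surjective c
  refine mt (fun h => ?_) hG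
  obtain ⟨k, hk⟩ := Subgroup.card_subgroup_dvd_card (Subgroup.centralizer {g})
  rw [hk, Nat.cast_mul, ← centralizerCard_mk, h, zero_mul]

theorem centralizerCard_zpowConjClasses_neg_one (c : ConjClasses G) :
    centralizerCard (zpowConjClasses (-1) c) = centralizerCard c := by
  obtain ⟨g, rfl⟩ := ConjClasses.mk_surjective c
  rw [zpowConjClasses_mk, zpow_neg_one, centralizerCard_mk, centralizerCard_mk]
  refine Nat.card_congr (Equiv.subtypeEquivRight fun x => ?_)
  simp only [Subgroup.mem_centralizer_singleton_iff]
  exact Commute.inv_right_iff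

end ConjClasses

section CharacterTable

variable {K G ι : Type*} [Field K] [Group G] {n : ι → Type*} [∀ i, Fintype (n i)]
  [∀ i, DecidableEq (n i)] (e : MonoidAlgebra K G ≃ₐ[K] ∀ i, Matrix (n i) (n i) K)

/-- The `i`-th irreducible matrix representation of `G` provided by a decomposition of `K[G]` into
matrix blocks. -/
noncomputable def blockRep (i : ι) : G →* Matrix (n i) (n i) K :=
  ((Pi.evalMonoidHom _ i).comp (e : MonoidAlgebra K G →* ∀ i, Matrix (n i) (n i) K)).comp
    (MonoidAlgebra.of K G)

theorem trace_blockRep_congr (i : ι) {g h : G} (hgh : IsConj g h) :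
    (blockRep e i g).trace = (blockRep e i h).trace := by
  obtain ⟨c, rfl⟩ := isConj_iff.1 hgh
  rw [map_mul, Matrix.trace_mul_comm, ← map_mul, ← mul_assoc, inv_mul_cancel, one_mul]

/-- The character table of `G` with entries in `K`: the rows are indexed by the blocks of `K[G]`,
the columns by the conjugacy classes, and the entries are the traces in the block
representations. -/
noncomputable def characterTable : Matrix ι (ConjClasses G) K :=
  Matrix.of fun i => Quotient.lift (fun g => (blockRep e i g).trace) fun _ _ =>
    trace_blockRep_congr e i

theorem characterTable_mk (i : ι) (g : G) :
    characterTable e i (ConjClasses.mk g) = (blockRep e i g).trace := rfl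

theorem characterTable_pow_char (q : ℕ) [Fact q.Prime] [CharP K q] (i : ι) (c : ConjClasses G) :
    characterTable e i c ^ q = characterTable e i (zpowConjClasses q c) := by
  obtain ⟨g, rfl⟩ := ConjClasses.mk_surjective c
  rw [zpowConjClasses_mk, zpow_natCast, characterTable_mk, characterTable_mk, map_pow,
    trace_pow_char q]

/-- Both sides are the trace of `a ↦ g * a * h` on `K[G]`. -/
theorem sum_trace_blockRep_mul_trace_blockRep [Fintype ι] [Finite G] (g h : G) :
    ∑ i, (blockRep e i g).trace * (blockRep e i h).trace =
      (Nat.card {x // g * x * h = x} : K) := by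
  rw [← trace_mulLeftRight_of, ← LinearMap.trace_conj' _ e.toLinearEquiv,
    AlgEquiv.linearEquivConj_mulLeftRight]
  exact (trace_mulLeftRight_pi_matrix _ _).symm

theorem transpose_characterTable_mul_apply [Fintype ι] [Finite G] (g h : G) :
    ((characterTable e)ᵀ * (characterTable e).submatrix id (zpowConjClasses (-1)))
      (ConjClasses.mk g) (ConjClasses.mk h) = (Nat.card {x // g * x * h⁻¹ = x} : K) := by
  rw [Matrix.mul_apply, ← sum_trace_blockRep_mul_trace_blockRep e]
  simp only [Matrix.transpose_apply, Matrix.submatrix_apply, id, zpowConjClasses_mk, zpow_neg_one,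
    characterTable_mk]

theorem transpose_characterTable_mul [Fintype ι] [Finite G] [DecidableEq (ConjClasses G)] :
    (characterTable e)ᵀ * (characterTable e).submatrix id (zpowConjClasses (-1)) =
      Matrix.diagonal fun c => (centralizerCard c : K) := by
  ext c d
  obtain ⟨h, rfl⟩ := ConjClasses.mk_surjective d
  rcases eq_or_ne c (ConjClasses.mk h) with rfl | hne
  · rw [transpose_characterTable_mul_apply, Matrix.diagonal_apply_eq, centralizerCard_mk]
    refine congrArg _ (Nat.card_congr (Equiv.subtypeEquivRight fun x => ?_))
    rw [Subgroup.mem_centralizer_singleton_iff, mul_inv_eq_iff_eq_mul, eq_comm]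
  · obtain ⟨g, rfl⟩ := ConjClasses.mk_surjective c
    have : IsEmpty {x // g * x * h⁻¹ = x} := by
      refine ⟨fun ⟨x, hx⟩ => hne ?_⟩
      rw [ConjClasses.mk_eq_mk_iff_isConj, isConj_comm, isConj_iff]
      exact ⟨x, by rw [mul_inv_eq_iff_eq_mul, ← mul_inv_eq_iff_eq_mul.1 hx]⟩
    rw [transpose_characterTable_mul_apply, Matrix.diagonal_apply_ne _ hne, Nat.card_of_isEmpty,
      Nat.cast_zero]

theorem linearIndependent_row_characterTable [Finite ι] [∀ i, Nonempty (n i)] :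
    LinearIndependent K (characterTable e).row := by
  classical
  have := Fintype.ofFinite ι
  refine Fintype.linearIndependent_iff.2 fun c hc j => ?_
  let φ : MonoidAlgebra K G →ₗ[K] K :=
    ∑ i, c i • (Matrix.traceLinearMap (n i) K K ∘ₗ LinearMap.proj i ∘ₗ e.toLinearMap)
  have hφ : φ = 0 := by
    refine MonoidAlgebra.lhom_ext' fun g => LinearMap.ext_ring ?_
    simpa [φ, characterTable_mk, blockRep] using congrFun hc (ConjClasses.mk g)
  obtain ⟨k⟩ := ‹∀ i, Nonempty (n i)› j
  have hj := LinearMap.congr_fun hφ (e.symm (Pi.single j (Matrix.single k k 1)))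
  simp only [φ, LinearMap.sum_apply, LinearMap.smul_apply, LinearMap.comp_apply,
    AlgEquiv.toLinearMap_apply, AlgEquiv.apply_symm_apply, LinearMap.proj_apply] at hj
  rw [Fintype.sum_eq_single j fun i hi => by simp [Pi.single_eq_of_ne hi]] at hj
  simpa using hj

theorem card_blocks_eq_card_conjClasses {K G ι : Type*} [Field K] [Group G] [Finite G]
    [Fintype (ConjClasses G)] [Fintype ι] {n : ι → Type*} [∀ i, Fintype (n i)]
    [∀ i, DecidableEq (n i)] [∀ i, Nonempty (n i)]
    (e : MonoidAlgebra K G ≃ₐ[K] ∀ i, Matrix (n i) (n i) K) (hG : (Nat.card G : K) ≠ 0) :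
    Fintype.card ι = Fintype.card (ConjClasses G) := by
  classical
  rw [← (linearIndependent_row_characterTable e).rank_matrix]
  refine le_antisymm (Matrix.rank_le_card_width _) ?_
  have hunit : IsUnit (Matrix.diagonal fun c : ConjClasses G => (centralizerCard c : K)) := by
    rw [Matrix.isUnit_diagonal, Pi.isUnit_iff]
    exact fun c => (centralizerCard_cast_ne_zero hG c).isUnit
  calc Fintype.card (ConjClasses G)
      = ((characterTable e)ᵀ * (characterTable e).submatrix id (zpowConjClasses (-1))).rank := by
        rw [transpose_characterTable_mul, Matrix.rank_of_isUnit _ hunit]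
    _ ≤ (characterTable e).rank := by
        rw [← Matrix.rank_transpose (characterTable e)]
        exact Matrix.rank_mul_le_left _ _

end CharacterTable

theorem isCoprime_neg_one_card (G : Type*) : IsCoprime (-1 : ℤ) (Nat.card G : ℤ) :=
  isCoprime_one_left.neg_left

theorem sign_powPermConjClasses_prime (G : Type*) [Group G] [Finite G] [Fintype (ConjClasses G)]
    [DecidableEq (ConjClasses G)] (q : ℕ) [Fact q.Prime] (hq : q ≠ 2)
    (hm : IsCoprime (q : ℤ) (Nat.card G : ℤ)) :
    (sign (powPermConjClasses G q hm) : ℤ) =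
      legendreSym q (sign (powPermConjClasses G (-1) (isCoprime_neg_one_card G)) *
        ∏ c : ConjClasses G, centralizerCard c) := by
  let K := AlgebraicClosure (ZMod q)
  have : CharP K q := charP_of_injective_algebraMap (algebraMap (ZMod q) K).injective q
  have hG : (Nat.card G : K) ≠ 0 := by
    rw [Ne, CharP.cast_eq_zero_iff K q, ← (Fact.out : q.Prime).coprime_iff_not_dvd]
    exact Nat.isCoprime_iff_coprime.1 hm
  have : NeZero (Nat.card G : K) := ⟨hG⟩
  obtain ⟨r, n, hn, ⟨e⟩⟩ :=
    IsSemisimpleRing.exists_algEquiv_pi_matrix_of_isAlgClosed K (MonoidAlgebra K G)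
  let f : ConjClasses G ≃ Fin r :=
    Fintype.equivOfCardEq (card_blocks_eq_card_conjClasses e hG).symm
  set J := powPermConjClasses G (-1) (isCoprime_neg_one_card G)
  let M := (characterTable e).submatrix f id
  have hJ : ((sign J : ℤ) : K) * (sign J : ℤ) = 1 := by
    rw [← Int.cast_mul, Int.units_coe_mul_self, Int.cast_one]
  have hMM : Mᵀ * M.submatrix id J = Matrix.diagonal fun c => (centralizerCard c : K) :=
    (Matrix.submatrix_mul_equiv _ _ id f id).trans (transpose_characterTable_mul e)
  have hdet : M.det * (((sign J : ℤ) : K) * M.det) =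
      ∏ c : ConjClasses G, (centralizerCard c : K) := by
    rw [← Matrix.det_permute', ← Matrix.det_transpose M, ← Matrix.det_mul, hMM,
      Matrix.det_diagonal]
  have hpow (c d : ConjClasses G) : M c d ^ q = M c (powPermConjClasses G q hm d) :=
    characterTable_pow_char e q (f c) d
  refine sign_eq_legendreSym_of_det_sq hq M _ hpow ?_ ?_
  all_goals rw [Int.cast_mul, Int.cast_natCast, Nat.cast_prod]
  · linear_combination ((sign J : ℤ) : K) * hdet - M.det ^ 2 * hJ
  · exact mul_ne_zero (left_ne_zero_of_mul_eq_one hJ)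
      (Finset.prod_ne_zero_iff.2 fun c _ => centralizerCard_cast_ne_zero hG c)

section SignedPermutation

theorem sign_eq_prod_snd {Y : Type*} [Fintype Y] [DecidableEq Y] (σ : Perm (Y × ℤˣ))
    (hσ : ∀ y u, σ (y, u) = ((σ (y, 1)).1, u * (σ (y, 1)).2)) :
    sign σ = ∏ y, (σ (y, 1)).2 := by
  have hinj : Function.Injective fun y => (σ (y, 1)).1 := by
    intro y z (hyz : (σ (y, 1)).1 = (σ (z, 1)).1)
    have : σ (y, (σ (y, 1)).2⁻¹) = σ (z, (σ (z, 1)).2⁻¹) := by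
      rw [hσ y, hσ z, hyz, inv_mul_cancel, inv_mul_cancel]
    exact congrArg Prod.fst (σ.injective this)
  let τ : Perm Y := Equiv.ofBijective _ (Finite.injective_iff_bijective.1 hinj)
  have hdecomp : σ = (prodCongrLeft fun _ : ℤˣ => τ) *
      prodCongrRight fun y => Equiv.mulRight (σ (y, 1)).2 :=
    Equiv.ext fun ⟨y, u⟩ => hσ y u
  have hmul : ∀ u : ℤˣ, sign (Equiv.mulRight u) = u := by decide
  calc sign σ = sign _ := congrArg sign hdecomp
    _ = ∏ y, (σ (y, 1)).2 := by
      simp [Perm.sign_mul, sign_prodCongrLeft, sign_prodCongrRight, hmul]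

theorem exists_sign_of_involutive {Y : Type*} {i : Y → Y} (hi : Function.Involutive i) :
    ∃ ε : Y → ℤˣ, ∀ y, i y ≠ y → ε (i y) = -ε y := by
  classical
  let := linearOrderOfSTO (WellOrderingRel (α := Y))
  refine ⟨fun y => if y < i y then 1 else -1, fun y hy => ?_⟩
  dsimp only
  rw [hi y]
  rcases lt_or_gt_of_ne hy with h | h
  · rw [if_pos h, if_neg h.not_gt, neg_neg]
  · rw [if_neg h.not_gt, if_pos h]

variable {X : Type*} {i : X → X} {ε : X → ℤˣ}

/-- A set with an involution that changes the sign `ε` of every point is the product of its positive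
half with the group of signs. -/
def equivPositiveProdUnits (hi : Function.Involutive i) (hε : ∀ x, ε (i x) = -ε x) :
    X ≃ {x // ε x = 1} × ℤˣ where
  toFun x := (⟨if ε x = 1 then x else i x, by
    rcases Int.units_eq_one_or (ε x) with h | h <;> simp [h, hε]⟩, ε x)
  invFun y := if y.2 = 1 then y.1 else i y.1
  left_inv x := by
    rcases Int.units_eq_one_or (ε x) with h | h <;> simp [h, hi x]
  right_inv := by
    rintro ⟨⟨x, hx⟩, u⟩
    rcases Int.units_eq_one_or u with rfl | rfl <;> simp [hx, hε, hi x]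

variable [Fintype X] [DecidableEq X] {σ : Perm X}

theorem sign_eq_prod_of_free_involution (hi : Function.Involutive i)
    (hε : ∀ x, ε (i x) = -ε x) (hσ : ∀ x, σ (i x) = i (σ x)) :
    sign σ = ∏ x : {x // ε x = 1}, ε (σ x) := by
  let E := equivPositiveProdUnits hi hε
  rw [sign_eq_sign_of_equiv σ (E.permCongr σ) E (by simp), sign_eq_prod_snd]
  · rfl
  · rintro y u
    rcases Int.units_eq_one_or u with rfl | rfl
    · simp
    · rcases Int.units_eq_one_or (ε (σ y)) with h | h <;>
      simp [E, equivPositiveProdUnits, hσ, hε, h, hi (σ y)]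

/-- Gauss's lemma, which is the case of a multiplication on `ZMod p` and of `i = (-·)`. -/
theorem sign_eq_prod_of_involution (hi : Function.Involutive i) (hσ : ∀ x, σ (i x) = i (σ x))
    (hfix : ∀ x, i x = x → σ x = x) (hε : ∀ x, i x ≠ x → ε (i x) = -ε x) :
    sign σ = ∏ x with i x ≠ x ∧ ε x = 1, ε (σ x) := by
  have hmove (x : X) : i (σ x) ≠ σ x ↔ i x ≠ x := by rw [← hσ, σ.injective.ne_iff]
  let i' : {x // i x ≠ x} → {x // i x ≠ x} := fun x => ⟨i x, by rw [hi x]; exact x.2.symm⟩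
  have hi' : Function.Involutive i' := fun x => Subtype.ext (hi x)
  calc sign σ = sign (σ.subtypePerm hmove) :=
        (sign_subtypePerm σ hmove fun x hx h => hx (hfix x h)).symm
    _ = ∏ x : {x : {x // i x ≠ x} // ε x = 1}, ε (σ x) := by
        convert sign_eq_prod_of_free_involution (σ := σ.subtypePerm hmove)
          (ε := fun x : {x // i x ≠ x} => ε x) hi' (fun x => hε x x.2) fun x => Subtype.ext (hσ x)
        rfl
    _ = ∏ x with i x ≠ x ∧ ε x = 1, ε (σ x) := by
        rw [Finset.prod_subtype _ fun x => Finset.mem_filter_univ x]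
        exact Fintype.prod_equiv (Equiv.subtypeSubtypeEquivSubtypeInter _ (ε · = 1)) _ _
          fun x => rfl

theorem sign_eq_one_of_involution (hi : Function.Involutive i) (hσ : ∀ x, σ (i x) = i (σ x))
    (hfix : ∀ x, σ.SameCycle x (i x) → σ x = x) : sign σ = 1 := by
  have hi_cycle (x y : X) (h : σ.SameCycle x y) : σ.SameCycle (i x) (i y) := by
    obtain ⟨k, -, rfl⟩ := h.exists_pow_eq'
    refine ⟨k, ?_⟩
    rw [zpow_natCast, coe_pow]
    exact Function.Commute.iterate_left hσ k x
  let j : Quotient (SameCycle.setoid σ) → Quotient (SameCycle.setoid σ) := Quotient.map i hi_cycle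
  have hj : Function.Involutive j := by
    rintro ⟨x⟩
    exact congrArg (Quotient.mk _) (hi x)
  -- A choice of signs for the cycles is constant along `σ`, so Gauss's lemma counts no change.
  obtain ⟨ε, hε⟩ := exists_sign_of_involutive hj
  rw [sign_eq_prod_of_involution (ε := fun x => ε (Quotient.mk _ x)) hi hσ]
  · refine Finset.prod_eq_one fun x hx => ?_
    have hσx : Quotient.mk (SameCycle.setoid σ) (σ x) = Quotient.mk _ x :=
      Quotient.sound (sameCycle_apply_left.2 (SameCycle.refl σ x))
    rw [hσx, (Finset.mem_filter.1 hx).2.2]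
  · exact fun x hx => hfix x (by rw [hx])
  · refine fun x hx => hε (Quotient.mk _ x) fun h => hx ?_
    have hcycle : σ.SameCycle x (i x) := (Quotient.exact h).symm
    exact (hcycle.eq_of_left (hfix x hcycle)).symm

/-- Gauss's lemma counts every sign of the base an odd number of times. -/
theorem sign_eq_sign_of_odd_card_fiber {X Y : Type*} [Fintype X] [DecidableEq X] [Fintype Y]
    [DecidableEq Y] {π : X → Y} (hπ : ∀ y, Odd #{x | π x = y}) {i : X → X} {j : Y → Y}
    (hi : Function.Involutive i) (hij : ∀ x, π (i x) = j (π x)) (hj : ∀ x, j (π x) = π x → i x = x)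
    {σ : Perm X} {τ : Perm Y} (hσ : ∀ x, σ (i x) = i (σ x)) (hfix : ∀ x, i x = x → σ x = x)
    (hτ : ∀ x, π (σ x) = τ (π x)) : sign σ = sign τ := by
  have hsurj : Function.Surjective π := fun y => by
    obtain ⟨x, hx⟩ := card_pos.1 (hπ y).pos
    exact ⟨x, (mem_filter.1 hx).2⟩
  have hji : Function.Involutive j := hsurj.forall.2 fun x => by rw [← hij, ← hij, hi x]
  obtain ⟨ε, hε⟩ := exists_sign_of_involutive hji
  have hmove (x : X) : i x ≠ x ↔ j (π x) ≠ π x :=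
    not_congr ⟨fun h => by rw [← hij, h], hj x⟩
  rw [sign_eq_prod_of_involution (ε := fun x => ε (π x)) hi hσ hfix fun x hx => by
      rw [hij, hε _ ((hmove x).1 hx)],
    sign_eq_prod_of_involution hji (hsurj.forall.2 fun x => by rw [← hij, ← hτ, hσ, hij, hτ])
      (hsurj.forall.2 fun x hx => by rw [← hτ, hfix x (hj x hx)]) hε,
    prod_filter, prod_filter, ← prod_fiberwise univ π]
  refine prod_congr rfl fun y _ => ?_
  rw [prod_congr rfl (g := fun _ => if j y ≠ y ∧ ε y = 1 then ε (τ y) else 1) fun x hx => ?_,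
    prod_const, Int.units_pow_eq_pow_mod_two, Nat.odd_iff.1 (hπ y), pow_one]
  simp only [hmove, hτ, (mem_filter.1 hx).2]

end SignedPermutation

section PowPerm

@[simp]
theorem powPerm_apply {G : Type*} [Group G] [Finite G] (m : ℤ) (hm : IsCoprime m (Nat.card G : ℤ))
    (g : G) : powPerm G m hm g = g ^ m := rfl

theorem powPerm_pow_apply {G : Type*} [Group G] [Finite G] (m : ℤ)
    (hm : IsCoprime m (Nat.card G : ℤ)) (k : ℕ) (g : G) :
    (powPerm G m hm ^ k) g = g ^ m ^ k := by
  induction k with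
  | zero => simp
  | succ k ih => rw [pow_succ', Perm.mul_apply, ih, powPerm_apply, ← zpow_mul, pow_succ]

theorem powPerm_congr (G : Type*) [Group G] [Finite G] {m k : ℤ} (hm : IsCoprime m (Nat.card G : ℤ))
    (hk : IsCoprime k (Nat.card G : ℤ)) (h : m ≡ k [ZMOD Nat.card G]) :
    powPerm G m hm = powPerm G k hk := by
  ext g
  rw [powPerm_apply, powPerm_apply, zpow_eq_zpow_iff_modEq]
  exact h.of_dvd (Int.natCast_dvd_natCast.2 (orderOf_dvd_natCard g))

theorem inv_eq_self_iff_sq_eq_one {G : Type*} [Group G] {g : G} : g⁻¹ = g ↔ g ^ 2 = 1 := by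
  rw [pow_two, inv_eq_iff_mul_eq_one]

theorem sign_powPerm_neg_one (G : Type*) [Group G] [Fintype G] [DecidableEq G] :
    sign (powPerm G (-1) (isCoprime_neg_one_card G)) =
      (-1) ^ ((Nat.card G - Nat.card (powEqOne G 2)) / 2) := by
  have hsq : powPerm G (-1) (isCoprime_neg_one_card G) ^ 2 = 1 := by
    ext g
    simp [powPerm_pow_apply]
  have hfix : Function.fixedPoints (powPerm G (-1) (isCoprime_neg_one_card G)) = powEqOne G 2 := by
    ext g
    change g ^ (-1 : ℤ) = g ↔ g ^ 2 = 1
    rw [zpow_neg_one, inv_eq_self_iff_sq_eq_one]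
  rw [sign_of_pow_two_eq_one hsq, ← Nat.card_eq_fintype_card, ← Nat.card_eq_fintype_card, hfix]

theorem sign_powPerm_prod (K H : Type*) [Group K] [Group H] [Fintype K] [Fintype H]
    [DecidableEq K] [DecidableEq H] (m : ℤ) (hm : IsCoprime m (Nat.card (K × H) : ℤ))
    (hK : IsCoprime m (Nat.card K : ℤ)) (hH : IsCoprime m (Nat.card H : ℤ)) :
    sign (powPerm (K × H) m hm) =
      sign (powPerm K m hK) ^ Nat.card H * sign (powPerm H m hH) ^ Nat.card K := by
  have hdecomp : powPerm (K × H) m hm = prodCongrLeft (fun _ : H => powPerm K m hK) *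
      prodCongrRight (fun _ : K => powPerm H m hH) := by
    ext x <;> rfl
  rw [hdecomp, Perm.sign_mul, sign_prodCongrLeft, sign_prodCongrRight, prod_const, prod_const,
    card_univ, card_univ, Nat.card_eq_fintype_card, Nat.card_eq_fintype_card]

theorem sign_powPerm_congr {G G' : Type*} [Group G] [Group G'] [Fintype G] [Fintype G']
    [DecidableEq G] [DecidableEq G'] (e : G ≃* G') (m : ℤ) (hm : IsCoprime m (Nat.card G : ℤ))
    (hm' : IsCoprime m (Nat.card G' : ℤ)) :
    sign (powPerm G m hm) = sign (powPerm G' m hm') :=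
  sign_eq_sign_of_equiv _ _ e.toEquiv fun g => map_zpow e g m

end PowPerm

section Kronecker

theorem kroneckerSym_of_odd (d : ℤ) {m : ℤ} (hm : Odd m) :
    kroneckerSym d m = (if m < 0 then kroneckerNegOne d else 1) * jacobiSym d m.natAbs := by
  have h0 : m ≠ 0 := by rintro rfl; simp at hm
  have h1 : m.natAbs.factorization 2 = 0 :=
    Nat.factorization_eq_zero_of_not_dvd (Int.natAbs_odd.2 hm).not_two_dvd_nat
  rw [kroneckerSym, if_neg h0, h1, pow_zero, pow_zero, mul_one, Nat.div_one]

theorem kroneckerSym_mul_sq (d : ℤ) {c m : ℤ} (hm : Odd m) (hc : IsCoprime c m) (hc0 : c ≠ 0) :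
    kroneckerSym (d * c ^ 2) m = kroneckerSym d m := by
  have hcm : c.gcd m.natAbs = 1 := by
    rw [← Int.isCoprime_iff_gcd_eq_one, Int.natCast_natAbs]
    exact hc.abs_right
  have hneg : kroneckerNegOne (d * c ^ 2) = kroneckerNegOne d := by
    have hlt : d * c ^ 2 < 0 ↔ d < 0 := by
      have := sq_pos_of_ne_zero hc0
      simp [mul_neg_iff, this, this.not_gt]
    simp only [kroneckerNegOne, hlt]
  rw [kroneckerSym_of_odd _ hm, kroneckerSym_of_odd _ hm, jacobiSym.mul_left, jacobiSym.pow_left,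
    jacobiSym.sq_one hcm, mul_one, hneg]

theorem kroneckerSym_neg_one_pow (k : ℕ) {m : ℤ} (hm : Odd m) :
    kroneckerSym ((-1) ^ k) m = if m % 4 = 1 then 1 else (-1) ^ k := by
  rcases Nat.even_or_odd k with hk | hk <;> rw [hk.neg_one_pow, kroneckerSym_of_odd _ hm]
  · simp [kroneckerNegOne, jacobiSym.one_left]
  · rw [jacobiSym.at_neg_one (Int.natAbs_odd.2 hm), ZMod.χ₄_nat_eq_if_mod_four, kroneckerNegOne]
    have := Int.odd_iff.1 hm
    split_ifs <;> omega

variable {n : ℕ}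

theorem neg_one_pow_half_mul_self (hn : Odd n) :
    (-1 : ℤ) ^ ((n - 1) / 2) * n = if n % 4 = 1 then (n : ℤ) else -n := by
  have := Nat.odd_iff.1 hn
  rcases Nat.even_or_odd ((n - 1) / 2) with h | h
  · rw [h.neg_one_pow, if_pos (by have := Nat.even_iff.1 h; omega), one_mul]
  · rw [h.neg_one_pow, if_neg (by have := Nat.odd_iff.1 h; omega), neg_one_mul]

theorem kroneckerNegOne_neg_one_pow_half_mul_self (hn : Odd n) :
    kroneckerNegOne ((-1) ^ ((n - 1) / 2) * n) = jacobiSym (-1) n := by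
  rw [jacobiSym.at_neg_one hn, neg_one_pow_half_mul_self hn, ZMod.χ₄_nat_eq_if_mod_four,
    kroneckerNegOne]
  have := Nat.odd_iff.1 hn
  split_ifs <;> omega

theorem kroneckerTwo_neg_one_pow_half_mul_self (hn : Odd n) :
    kroneckerTwo ((-1) ^ ((n - 1) / 2) * n) = jacobiSym 2 n := by
  rw [jacobiSym.at_two hn, neg_one_pow_half_mul_self hn, ZMod.χ₈_nat_eq_if_mod_eight,
    kroneckerTwo]
  have := Nat.odd_iff.1 hn
  split_ifs <;> omega

theorem jacobiSym_neg_one_pow_half_mul_self (hn : Odd n) {b : ℕ} (hb : Odd b) :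
    jacobiSym ((-1) ^ ((n - 1) / 2) * n) b = jacobiSym b n := by
  have hhalf : (n - 1) / 2 = n / 2 := by
    have := Nat.odd_iff.1 hn
    omega
  rw [hhalf, jacobiSym.mul_left, jacobiSym.pow_left, jacobiSym.at_neg_one hb,
    ZMod.χ₄_eq_neg_one_pow (Nat.odd_iff.1 hb), ← pow_mul, jacobiSym.quadratic_reciprocity hn hb,
    ← mul_assoc, mul_comm (b / 2), ← pow_add, ← two_mul, pow_mul, neg_one_sq, one_pow, one_mul]

theorem jacobiSym_eq_sign_mul_two_mul_ordCompl (m : ℤ) (n : ℕ) :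
    jacobiSym m n = (if m < 0 then jacobiSym (-1) n else 1) *
      jacobiSym 2 n ^ m.natAbs.factorization 2 *
      jacobiSym (m.natAbs / 2 ^ m.natAbs.factorization 2 : ℕ) n := by
  have hm : m = (if m < 0 then -1 else 1) * 2 ^ m.natAbs.factorization 2 *
      (m.natAbs / 2 ^ m.natAbs.factorization 2 : ℕ) := by
    have habs : (m.natAbs : ℤ) = 2 ^ m.natAbs.factorization 2 *
        (m.natAbs / 2 ^ m.natAbs.factorization 2 : ℕ) :=
      mod_cast (Nat.ordProj_mul_ordCompl_eq_self m.natAbs 2).symm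
    rw [mul_assoc, ← habs]
    split_ifs <;> omega
  conv_lhs => rw [hm]
  rw [jacobiSym.mul_left, jacobiSym.mul_left, jacobiSym.pow_left]
  split_ifs
  · rfl
  · rw [jacobiSym.one_left]

theorem kroneckerSym_neg_one_pow_half_mul_self (hn : Odd n) {m : ℤ}
    (hm : IsCoprime m (n : ℤ)) :
    kroneckerSym ((-1) ^ ((n - 1) / 2) * n) m = jacobiSym m n := by
  rcases eq_or_ne m 0 with rfl | hm0
  · obtain rfl : n = 1 := by simpa [isCoprime_zero_left, Int.isUnit_iff_natAbs_eq] using hm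
    simp [kroneckerSym]
  · have hodd : Odd (m.natAbs / 2 ^ m.natAbs.factorization 2) :=
      Nat.coprime_two_left.1 (Nat.coprime_ordCompl Nat.prime_two (Int.natAbs_ne_zero.2 hm0))
    rw [kroneckerSym, if_neg hm0, kroneckerNegOne_neg_one_pow_half_mul_self hn,
      kroneckerTwo_neg_one_pow_half_mul_self hn, jacobiSym_neg_one_pow_half_mul_self hn hodd,
      ← jacobiSym_eq_sign_mul_two_mul_ordCompl]

end Kronecker

section OddOrder

variable {G : Type*} [Group G]

theorem sq_eq_one_iff_of_odd_card (hG : Odd (Nat.card G)) {g : G} : g ^ 2 = 1 ↔ g = 1 :=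
  hG.coprime_two_right.pow_left_bijective.injective.eq_iff' (one_pow 2)

theorem card_powEqOne_two_of_odd_card (hG : Odd (Nat.card G)) : Nat.card (powEqOne G 2) = 1 := by
  have : powEqOne G 2 = {1} := Set.ext fun g => sq_eq_one_iff_of_odd_card hG
  rw [this, Nat.card_unique]

theorem isConj_inv_self_iff_of_odd_card (hG : Odd (Nat.card G)) {g : G} :
    IsConj g g⁻¹ ↔ g = 1 := by
  refine ⟨fun h => ?_, fun h => by simp [h]⟩
  obtain ⟨x, hx⟩ := h
  have hx : SemiconjBy (x : G) g g⁻¹ := hx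
  have hx2 : Commute ((x : G) ^ 2) g := by
    rw [pow_two]
    exact (by simpa using hx.inv_right : SemiconjBy (x : G) g⁻¹ g).mul_left hx
  -- Conjugation by an odd power of `x` inverts `g`, and `x ^ |G| = 1` is such a power.
  obtain ⟨k, hk⟩ := hG
  have h1 : SemiconjBy ((x : G) ^ Nat.card G) g g⁻¹ := by
    rw [hk, pow_succ', pow_mul]
    exact hx.mul_left (hx2.pow_left k)
  rw [pow_card_eq_one', SemiconjBy, one_mul, mul_one] at h1
  exact (sq_eq_one_iff_of_odd_card ⟨k, hk⟩).1 (inv_eq_self_iff_sq_eq_one.1 h1.symm)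

theorem zpowConjClasses_neg_one_eq_self_iff (hG : Odd (Nat.card G)) {c : ConjClasses G} :
    zpowConjClasses (-1) c = c ↔ c = 1 := by
  obtain ⟨g, rfl⟩ := ConjClasses.mk_surjective c
  rw [zpowConjClasses_mk, zpow_neg_one, eq_comm, ConjClasses.one_eq_mk_one,
    ConjClasses.mk_eq_mk_iff_isConj, ConjClasses.mk_eq_mk_iff_isConj, isConj_one_left,
    isConj_inv_self_iff_of_odd_card hG]

theorem card_filter_mk_eq_dvd_card [Fintype G] [DecidableEq (ConjClasses G)] (c : ConjClasses G) :
    #{g | ConjClasses.mk g = c} ∣ Nat.card G := by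
  obtain ⟨g, rfl⟩ := ConjClasses.mk_surjective c
  have horbit : (MulAction.orbit (ConjAct G) g).ncard = #{x | ConjClasses.mk x = .mk g} := by
    rw [ConjAct.orbit_eq_carrier_conjClasses, ← Set.ncard_coe_finset]
    congr 1
    ext x
    simp [ConjClasses.mem_carrier_iff_mk_eq]
  rw [← horbit, ← MulAction.index_stabilizer]
  exact Subgroup.index_dvd_card (MulAction.stabilizer (ConjAct G) g)

theorem legendreSym_prod_centralizerCard [Finite G] [Fintype (ConjClasses G)]
    (hG : Odd (Nat.card G)) (q : ℕ) [Fact q.Prime] (hq : IsCoprime (q : ℤ) (Nat.card G : ℤ)) :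
    legendreSym q (∏ c : ConjClasses G, centralizerCard c : ℕ) = legendreSym q (Nat.card G) := by
  classical
  have hcard : (Nat.card G : ZMod q) ≠ 0 := by
    rw [Ne, ZMod.natCast_eq_zero_iff, ← (Fact.out : q.Prime).coprime_iff_not_dvd]
    exact Nat.isCoprime_iff_coprime.1 hq
  -- Outside the trivial class, a class and its inverse are distinct and contribute a square.
  have hpairs : ∏ c ∈ univ.erase (1 : ConjClasses G), legendreSym q (centralizerCard c) = 1 := by
    refine prod_involution (fun c _ => zpowConjClasses (-1) c) (fun c _ => ?_) (fun c hc _ => ?_)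
      (fun c hc => ?_) fun c _ => zpowConjClasses_neg_one_involutive c
    · rw [centralizerCard_zpowConjClasses_neg_one, ← pow_two]
      exact legendreSym.sq_one q (by simpa using centralizerCard_cast_ne_zero hcard c)
    · exact mt (zpowConjClasses_neg_one_eq_self_iff hG).1 (ne_of_mem_erase hc)
    · refine mem_erase.2 ⟨fun h => ne_of_mem_erase hc ?_, mem_univ _⟩
      rw [← zpowConjClasses_neg_one_involutive c, h, zpowConjClasses_neg_one_eq_self_iff hG]
  calc legendreSym q (∏ c : ConjClasses G, centralizerCard c : ℕ)
    _ = ∏ c : ConjClasses G, legendreSym q (centralizerCard c) := by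
      rw [Nat.cast_prod]
      exact map_prod (legendreSym.hom q) _ _
    _ = legendreSym q (Nat.card G) := by
      rw [← mul_prod_erase univ _ (mem_univ 1), hpairs, mul_one, centralizerCard_one]

theorem sign_powPerm_eq_sign_powPermConjClasses [Fintype G] [DecidableEq G]
    [Fintype (ConjClasses G)] [DecidableEq (ConjClasses G)] (hG : Odd (Nat.card G)) (m : ℤ)
    (hm : IsCoprime m (Nat.card G : ℤ)) :
    sign (powPerm G m hm) = sign (powPermConjClasses G m hm) := by
  have hinv {g : G} : g⁻¹ = g ↔ g = 1 :=
    inv_eq_self_iff_sq_eq_one.trans (sq_eq_one_iff_of_odd_card hG)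
  refine sign_eq_sign_of_odd_card_fiber (π := ConjClasses.mk) (i := (·⁻¹))
    (j := zpowConjClasses (-1)) (fun c => hG.of_dvd_nat (card_filter_mk_eq_dvd_card c)) inv_inv
    ?_ ?_ ?_ ?_ fun g => rfl
  · exact fun g => by rw [zpowConjClasses_mk, zpow_neg_one]
  · exact fun g hg => by
      rw [zpowConjClasses_neg_one_eq_self_iff hG, ConjClasses.one_eq_mk_one,
        ConjClasses.mk_eq_mk_iff_isConj, isConj_one_left] at hg
      exact hinv.2 hg
  · exact fun g => inv_zpow g m
  · exact fun g hg => by rw [hinv.1 hg, powPerm_apply, one_zpow]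

theorem sign_powPerm_of_odd_card [Fintype G] [DecidableEq G] (hG : Odd (Nat.card G)) (m : ℤ)
    (hm : IsCoprime m (Nat.card G : ℤ)) :
    (sign (powPerm G m hm) : ℤ) = jacobiSym m (Nat.card G) := by
  classical
  have := Fintype.ofFinite (ConjClasses G)
  obtain ⟨q, hq2, hq, hqm⟩ := Nat.forall_exists_prime_gt_and_zmodEq 2 Nat.card_pos.ne' hm
  have : Fact q.Prime := ⟨hq⟩
  have hqG : IsCoprime (q : ℤ) (Nat.card G : ℤ) := by
    rw [Int.isCoprime_iff_gcd_eq_one, ← Int.gcd_emod] at hm ⊢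
    rwa [hqm]
  rw [powPerm_congr G hm hqG hqm.symm, sign_powPerm_eq_sign_powPermConjClasses hG,
    sign_powPermConjClasses_prime G q hq2.ne' hqG, legendreSym.mul,
    legendreSym_prod_centralizerCard hG q hqG, ← legendreSym.mul,
    ← sign_powPerm_eq_sign_powPermConjClasses hG, sign_powPerm_neg_one,
    card_powEqOne_two_of_odd_card hG, jacobiSym.legendreSym.to_jacobiSym]
  push_cast
  rw [jacobiSym_neg_one_pow_half_mul_self hG (hq.odd_of_ne_two hq2.ne')]
  exact jacobiSym.mod_left' hqm

theorem dGroup_of_odd_card (hG : Odd (Nat.card G)) :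
    dGroup G = (-1) ^ ((Nat.card G - 1) / 2) * Nat.card G := by
  have h : Nat.card G ≠ 2 * numSylowTwo G := fun h =>
    Nat.not_even_iff_odd.2 hG (h ▸ even_two_mul _)
  rw [dGroup, card_powEqOne_two_of_odd_card hG, epsGroup, if_neg h, pow_zero, pow_one, Nat.div_one]

theorem sign_powPerm_eq_kroneckerSym_of_odd_card [Fintype G] [DecidableEq G]
    (hG : Odd (Nat.card G)) (m : ℤ) (hm : IsCoprime m (Nat.card G : ℤ)) :
    (sign (powPerm G m hm) : ℤ) = kroneckerSym (dGroup G) m := by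
  rw [sign_powPerm_of_odd_card hG, dGroup_of_odd_card hG,
    kroneckerSym_neg_one_pow_half_mul_self hG hm]

end OddOrder

theorem zpow_eq_self_of_sq_eq_one {G : Type*} [Group G] {g : G} (hg : g ^ 2 = 1) {m : ℤ}
    (hm : Odd m) : g ^ m = g := by
  obtain ⟨k, rfl⟩ := hm
  rw [zpow_add, zpow_mul, zpow_one, zpow_ofNat, hg, one_zpow, one_mul]

theorem odd_of_isCoprime_of_even {m : ℤ} {n : ℕ} (hm : IsCoprime m (n : ℤ)) (hn : Even n) :
    Odd m :=
  Int.isCoprime_two_right.1 (hm.of_isCoprime_of_dvd_right (mod_cast hn.two_dvd))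

section OddTimesTwoGroup

theorem sq_eq_one_of_zpow_eq_inv {H : Type*} [Group H] (hH : IsPGroup 2 H) {x : H} {a : ℤ}
    (ha : a ≡ 1 [ZMOD 4]) (hx : x ^ a = x⁻¹) : x ^ 2 = 1 := by
  obtain ⟨k, hk⟩ := IsPGroup.iff_orderOf.1 hH x
  have hdvd : (orderOf x : ℤ) ∣ a + 1 :=
    orderOf_dvd_iff_zpow_eq_one.2 (by rw [zpow_add, hx, zpow_one, inv_mul_cancel])
  -- Since `a + 1` is `2` modulo `4`, the order of `x` cannot be divisible by `4`.
  have hk1 : k ≤ 1 := by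
    by_contra! hk2
    have h4 : (4 : ℤ) ∣ orderOf x := by
      rw [hk]
      exact_mod_cast pow_dvd_pow 2 hk2
    have := h4.trans hdvd
    have : a % 4 = 1 := ha
    omega
  rw [← orderOf_dvd_iff_pow_eq_one, hk]
  exact pow_dvd_pow 2 hk1

theorem sign_powPerm_of_isPGroup_two {H : Type*} [Group H] [Fintype H] [DecidableEq H]
    (hH : IsPGroup 2 H) {m : ℤ} (hm : IsCoprime m (Nat.card H : ℤ)) (h4 : m ≡ 1 [ZMOD 4]) :
    sign (powPerm H m hm) = 1 := by
  refine sign_eq_one_of_involution (i := (·⁻¹)) inv_inv (fun x => inv_zpow x m) fun x hx => ?_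
  obtain ⟨k, -, hk⟩ := hx.exists_pow_eq'
  rw [powPerm_pow_apply] at hk
  have hodd : Odd m := by
    have : m % 4 = 1 := h4
    exact Int.odd_iff.2 (by omega)
  exact zpow_eq_self_of_sq_eq_one (sq_eq_one_of_zpow_eq_inv hH (by simpa using h4.pow k) hk) hodd

theorem sign_powPerm_prod_of_isPGroup_two {K H : Type*} [Group K] [Group H] [Fintype K]
    [Fintype H] [DecidableEq K] [DecidableEq H] (hH : IsPGroup 2 H) (hH2 : Even (Nat.card H))
    {m : ℤ} (hm : IsCoprime m (Nat.card (K × H) : ℤ)) (h4 : m ≡ 1 [ZMOD 4]) :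
    sign (powPerm (K × H) m hm) = 1 := by
  have hm' := hm
  rw [Nat.card_prod, Nat.cast_mul] at hm'
  rw [sign_powPerm_prod K H m hm hm'.of_mul_right_left hm'.of_mul_right_right,
    sign_powPerm_of_isPGroup_two hH _ h4, one_pow, mul_one, Int.units_pow_eq_pow_mod_two,
    Nat.even_iff.1 hH2, pow_zero]

theorem sign_powPerm_of_modEq_neg_one {G : Type*} [Group G] [Fintype G] [DecidableEq G] {m : ℤ}
    (hm : IsCoprime m (Nat.card G : ℤ)) (hneg : sign (powPerm G (-m) hm.neg_left) = 1) :
    sign (powPerm G m hm) = (-1) ^ ((Nat.card G - Nat.card (powEqOne G 2)) / 2) := by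
  have hmul : powPerm G m hm =
      powPerm G (-m) hm.neg_left * powPerm G (-1) (isCoprime_neg_one_card G) := by
    ext g
    simp
  rw [hmul, Perm.sign_mul, hneg, one_mul, sign_powPerm_neg_one]

theorem numSylowTwo_eq_one_of_normal {G : Type*} [Group G] [Finite G] {N : Subgroup G} [N.Normal]
    (hN : IsPGroup 2 N) (hindex : Odd N.index) : numSylowTwo G = 1 := by
  let P : Sylow 2 G := hN.toSylow hindex.not_two_dvd_nat
  have hP : (P : Subgroup G).Normal := by rwa [IsPGroup.toSylow_coe]
  have := Sylow.unique_of_normal P hP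
  rw [numSylowTwo, Nat.card_unique]

theorem even_card_powEqOne_two {G : Type*} [Group G] [Finite G] (hG : Even (Nat.card G)) :
    Even (Nat.card (powEqOne G 2)) := by
  have h1 := card_sub_card_powEqOne_even G
  have h2 : Nat.card (powEqOne G 2) ≤ Nat.card G :=
    Nat.card_le_card_of_injective _ Subtype.val_injective
  rw [Nat.even_iff] at hG ⊢
  omega

theorem kroneckerSym_dGroup_of_numSylowTwo_eq_one {G : Type*} [Group G] [Finite G]
    (hG : Even (Nat.card G)) (hn : numSylowTwo G = 1) {m : ℤ}
    (hm : IsCoprime m (Nat.card G : ℤ)) :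
    kroneckerSym (dGroup G) m =
      if m % 4 = 1 then 1 else (-1) ^ ((Nat.card G - Nat.card (powEqOne G 2)) / 2) := by
  have hodd : Odd m := odd_of_isCoprime_of_even hm hG
  obtain ⟨r, hr⟩ := even_card_powEqOne_two hG
  have hsq : ((Nat.card G ^ Nat.card (powEqOne G 2) / numSylowTwo G ^ epsGroup G : ℕ) : ℤ) =
      ((Nat.card G : ℤ) ^ r) ^ 2 := by
    rw [hn, one_pow, Nat.div_one, hr, ← mul_two, pow_mul, Nat.cast_pow, Nat.cast_pow]
  rw [dGroup, hsq, kroneckerSym_mul_sq _ hodd hm.symm.pow_left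
    (pow_ne_zero _ (Nat.cast_ne_zero.2 Nat.card_pos.ne')), kroneckerSym_neg_one_pow _ hodd]

theorem numSylowTwo_eq_one_of_mulEquiv_prod {G K H : Type*} [Group G] [Group K] [Group H] [Finite G]
    (hK : Odd (Nat.card K)) (hH : IsPGroup 2 H) (e : G ≃* K × H) : numSylowTwo G = 1 := by
  let f : G →* K := (MonoidHom.fst K H).comp e.toMonoidHom
  have hf : Function.Surjective f := Prod.fst_surjective.comp e.surjective
  have hker : IsPGroup 2 f.ker := by
    refine hH.of_injective ((MonoidHom.snd K H).comp (e.toMonoidHom.comp f.ker.subtype)) ?_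
    exact fun x y hxy => Subtype.ext (e.injective (Prod.ext (x.2.trans y.2.symm) hxy))
  refine numSylowTwo_eq_one_of_normal hker ?_
  rwa [Subgroup.index_ker, MonoidHom.range_eq_top.2 hf, Subgroup.card_top]

theorem sign_powPerm_eq_kroneckerSym_of_isOddTimesTwoGroup {G : Type*} [Group G] [Fintype G]
    [DecidableEq G] (hG : IsOddTimesTwoGroup G) (m : ℤ) (hm : IsCoprime m (Nat.card G : ℤ)) :
    (sign (powPerm G m hm) : ℤ) = kroneckerSym (dGroup G) m := by
  classical
  rcases (Nat.card G).even_or_odd with hG2 | hG2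
  swap
  · exact sign_powPerm_eq_kroneckerSym_of_odd_card hG2 m hm
  obtain ⟨K, H, _, _, hK, hH, ⟨e⟩⟩ := hG
  have : Finite (K × H) := Finite.of_equiv G e.toEquiv
  have : Fintype K := Fintype.ofSurjective _ (Prod.fst_surjective.comp e.surjective)
  have : Fintype H := Fintype.ofSurjective _ (Prod.snd_surjective.comp e.surjective)
  have hcard : Nat.card G = Nat.card (K × H) := Nat.card_congr e.toEquiv
  have hH2 : Even (Nat.card H) := by
    rw [hcard, Nat.card_prod, Nat.even_mul] at hG2
    exact hG2.resolve_left (Nat.not_even_iff_odd.2 hK)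
  have hone {k : ℤ} (hk : IsCoprime k (Nat.card G : ℤ)) (h4 : k ≡ 1 [ZMOD 4]) :
      sign (powPerm G k hk) = 1 :=
    (sign_powPerm_congr e k hk (hcard ▸ hk)).trans (sign_powPerm_prod_of_isPGroup_two hH hH2 _ h4)
  rw [kroneckerSym_dGroup_of_numSylowTwo_eq_one hG2
    (numSylowTwo_eq_one_of_mulEquiv_prod hK hH e) hm]
  split_ifs with h4
  · rw [hone hm h4, Units.val_one]
  · have := Int.odd_iff.1 (odd_of_isCoprime_of_even hm hG2)
    have hneg : -m ≡ 1 [ZMOD 4] := by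
      change -m % 4 = 1
      omega
    simp [sign_powPerm_of_modEq_neg_one hm (hone hm.neg_left hneg)]

end OddTimesTwoGroup

section TwiceOdd

variable {G : Type*} [Group G]

theorem exists_subgroup_index_two [Finite G] {n : ℕ} (hn : Odd n) (hG : Nat.card G = 2 * n) :
    ∃ N : Subgroup G, N.index = 2 := by
  classical
  have := Fintype.ofFinite G
  -- An involution acts by translation as a product of `n` transpositions, an odd permutation.
  let f : G →* ℤˣ := sign.comp (MulAction.toPermHom G G)
  obtain ⟨t, ht⟩ := exists_prime_orderOf_dvd_card' (G := G) 2 (hG ▸ dvd_mul_right 2 n)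
  have ht1 : t ≠ 1 := by
    rintro rfl
    simp at ht
  have hft : f t = -1 := by
    have hsq : MulAction.toPermHom G G t ^ 2 = 1 := by
      rw [← map_pow, ← ht, pow_orderOf_eq_one, map_one]
    have : IsEmpty (Function.fixedPoints (MulAction.toPermHom G G t)) :=
      ⟨fun x => ht1 (mul_eq_right.1 x.2)⟩
    change sign (MulAction.toPermHom G G t) = -1
    rw [sign_of_pow_two_eq_one hsq, ← Nat.card_eq_fintype_card, ← Nat.card_eq_fintype_card, hG,
      Nat.card_of_isEmpty, Nat.sub_zero, Nat.mul_div_cancel_left _ two_pos, hn.neg_one_pow]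
  refine ⟨f.ker, Subgroup.index_eq_two_iff.2 ⟨t, fun b => ?_⟩⟩
  rw [MonoidHom.mem_ker, MonoidHom.mem_ker, map_mul, hft]
  rcases Int.units_eq_one_or (f b) with h | h <;> rw [h] <;> decide

theorem even_orderOf_of_notMem_of_index_eq_two {N : Subgroup G} (hN : N.index = 2) {g : G}
    (hg : g ∉ N) : Even (orderOf g) := by
  rw [← Nat.not_odd_iff_even]
  rintro ⟨k, hk⟩
  have hsq : (g ^ 2) ^ k * g ∈ N := by
    rw [← pow_mul, ← pow_succ, ← hk, pow_orderOf_eq_one]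
    exact N.one_mem
  exact hg ((N.mul_mem_cancel_left (N.pow_mem (Subgroup.sq_mem_of_index_two hN g) k)).1 hsq)

/-- A subgroup of index `2` and odd order all of whose complement consists of involutions: the
structure of a generalized dihedral group. -/
structure IsOddDihedralKernel (N : Subgroup G) : Prop where
  index_eq_two : N.index = 2
  odd_card : Odd (Nat.card N)
  sq_eq_one : ∀ g ∉ N, g ^ 2 = 1

theorem IsTwiceOddWithInvolutions.exists_isOddDihedralKernel [Finite G]
    (hG : IsTwiceOddWithInvolutions G) : ∃ N : Subgroup G, IsOddDihedralKernel N := by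
  obtain ⟨⟨n, hn, hcard⟩, hinvol⟩ := hG
  obtain ⟨N, hN⟩ := exists_subgroup_index_two hn hcard
  refine ⟨N, hN, ?_, fun g hg => ?_⟩
  · have := N.card_mul_index
    rwa [(by lia : Nat.card N = n)]
  · rw [← hinvol g (even_orderOf_of_notMem_of_index_eq_two hN hg), pow_orderOf_eq_one]

namespace IsOddDihedralKernel

variable {N : Subgroup G}

theorem eq_one_of_sq_eq_one (hN : IsOddDihedralKernel N) {g : G} (hg : g ∈ N) (h : g ^ 2 = 1) :
    g = 1 :=
  congrArg Subtype.val ((sq_eq_one_iff_of_odd_card hN.odd_card (g := ⟨g, hg⟩)).1 (Subtype.ext h))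

theorem card_eq [Finite G] (hN : IsOddDihedralKernel N) : Nat.card G = 2 * Nat.card N := by
  rw [← N.card_mul_index, hN.index_eq_two, mul_comm]

theorem card_powEqOne_two [Finite G] (hN : IsOddDihedralKernel N) :
    Nat.card (powEqOne G 2) = Nat.card N + 1 := by
  have hcompl : powEqOne G 2 = ((N : Set G) \ {1})ᶜ := by
    ext g
    simp only [powEqOne, Set.mem_ofPred_eq, Set.mem_compl_iff, Set.mem_sdiff, SetLike.mem_coe,
      Set.mem_singleton_iff, not_and, not_not]
    refine ⟨fun h hg => hN.eq_one_of_sq_eq_one hg h, fun h => ?_⟩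
    by_cases hg : g ∈ N
    · rw [h hg, one_pow]
    · exact hN.sq_eq_one g hg
  have hadd := Set.ncard_add_ncard_compl ((N : Set G) \ {1})
  rw [← hcompl, Set.ncard_sdiff_singleton_of_mem N.one_mem, ← Nat.card_coe_set_eq,
    ← Nat.card_coe_set_eq, hN.card_eq, SetLike.coe_sort_coe] at hadd
  have := hN.odd_card.pos
  lia

theorem eq_one_or_eq_of_commute (hN : IsOddDihedralKernel N) {g t : G} (ht : t ∉ N)
    (hgt : Commute g t) : g = 1 ∨ g = t := by
  have hmul : g * t ∈ N ↔ g ∉ N := by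
    rw [Subgroup.mul_mem_iff_of_index_two hN.index_eq_two]
    tauto
  have hsq : (g * t) ^ 2 = g ^ 2 := by rw [hgt.mul_pow, hN.sq_eq_one t ht, mul_one]
  by_cases hg : g ∈ N
  · exact .inl (hN.eq_one_of_sq_eq_one hg (hsq ▸ hN.sq_eq_one _ fun h => hmul.1 h hg))
  · have : g * t = 1 := hN.eq_one_of_sq_eq_one (hmul.2 hg) (hsq.trans (hN.sq_eq_one g hg))
    rw [← inv_eq_self_iff_sq_eq_one.2 (hN.sq_eq_one t ht)]
    exact .inr (eq_inv_of_mul_eq_one_left this)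

theorem card_sylow_two [Finite G] (hN : IsOddDihedralKernel N) (P : Sylow 2 G) :
    Nat.card P = 2 := by
  have hfact : (Nat.card G).factorization 2 = 1 := by
    rw [hN.card_eq, Nat.factorization_mul two_ne_zero hN.odd_card.pos.ne', Finsupp.add_apply,
      Nat.prime_two.factorization_self,
      Nat.factorization_eq_zero_of_not_dvd hN.odd_card.not_two_dvd_nat]
  rw [P.card_eq_multiplicity, hfact, pow_one]

theorem normalizer_sylow_two [Finite G] (hN : IsOddDihedralKernel N) (P : Sylow 2 G) :
    Subgroup.normalizer (P : Set G) = P := by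
  obtain ⟨t, ht1, ht⟩ := (Nat.card_eq_two_iff' (1 : P)).1 (hN.card_sylow_two P)
  have ht2 : t.1 ^ 2 = 1 := by
    have h : t ^ Nat.card P = 1 := pow_card_eq_one'
    rw [hN.card_sylow_two] at h
    exact congrArg Subtype.val h
  have htN : t.1 ∉ N := fun h => ht1 (Subtype.ext (hN.eq_one_of_sq_eq_one h ht2))
  refine le_antisymm (fun g hg => ?_) Subgroup.le_normalizer
  have hconj : g * t.1 * g⁻¹ = t := by
    refine congrArg Subtype.val
      (ht ⟨g * t.1 * g⁻¹, (Subgroup.mem_normalizer_iff.1 hg t.1).1 t.2⟩ fun h => ht1 ?_)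
    exact Subtype.ext (conj_eq_one_iff.1 (congrArg Subtype.val h))
  obtain rfl | rfl := hN.eq_one_or_eq_of_commute htN (mul_inv_eq_iff_eq_mul.1 hconj)
  · exact P.one_mem
  · exact t.2

theorem numSylowTwo_eq [Finite G] (hN : IsOddDihedralKernel N) : numSylowTwo G = Nat.card N := by
  obtain ⟨P⟩ : Nonempty (Sylow 2 G) := inferInstance
  have hP : Nat.card P * (P : Subgroup G).index = Nat.card G := (P : Subgroup G).card_mul_index
  rw [hN.card_sylow_two, hN.card_eq] at hP
  rw [numSylowTwo, P.card_eq_index_normalizer, hN.normalizer_sylow_two]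
  exact Nat.eq_of_mul_eq_mul_left two_pos hP

theorem dGroup_eq [Finite G] (hN : IsOddDihedralKernel N) {k : ℕ}
    (hk : Nat.card N = 2 * k + 1) :
    dGroup G = ((-1) ^ ((Nat.card N - 1) / 2) * (Nat.card N : ℤ)) *
      (2 ^ (k + 1) * (Nat.card N : ℤ) ^ k) ^ 2 := by
  have hquot : (2 * Nat.card N) ^ (Nat.card N + 1) / Nat.card N =
      Nat.card N * (2 ^ (k + 1) * Nat.card N ^ k) ^ 2 := by
    apply Nat.div_eq_of_eq_mul_left hN.odd_card.pos
    rw [show Nat.card N + 1 = 2 * (k + 1) by lia]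
    ring
  have hexp : (2 * Nat.card N - (Nat.card N + 1)) / 2 = (Nat.card N - 1) / 2 := by lia
  rw [dGroup, epsGroup, hN.numSylowTwo_eq, hN.card_powEqOne_two, hN.card_eq, if_pos rfl, pow_one,
    hquot, hexp]
  push_cast
  ring

theorem sign_powPerm_eq [Fintype G] [DecidableEq G] [Fintype N]
    (hN : IsOddDihedralKernel N) {m : ℤ}
    (hm : IsCoprime m (Nat.card G : ℤ)) (hmN : IsCoprime m (Nat.card N : ℤ)) :
    sign (powPerm G m hm) = sign (powPerm N m hmN) := by
  classical
  have hodd : Odd m := odd_of_isCoprime_of_even hm (hN.card_eq ▸ even_two_mul _)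
  have hfix : ∀ g ∉ N, powPerm G m hm g = g := fun g hg =>
    zpow_eq_self_of_sq_eq_one (hN.sq_eq_one g hg) hodd
  have hmem : ∀ g, powPerm G m hm g ∈ N ↔ g ∈ N := fun g =>
    ⟨fun h => by_contra fun hg => hg (hfix g hg ▸ h), fun h => N.zpow_mem h m⟩
  have hsub : (powPerm G m hm).subtypePerm hmem = powPerm N m hmN := Perm.ext fun _ => rfl
  rw [← sign_subtypePerm _ hmem fun g hg => by_contra fun h => hg (hfix g h), hsub]
  congr!

theorem sign_powPerm_eq_kroneckerSym [Fintype G] [DecidableEq G]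
    (hN : IsOddDihedralKernel N) {m : ℤ}
    (hm : IsCoprime m (Nat.card G : ℤ)) :
    (sign (powPerm G m hm) : ℤ) = kroneckerSym (dGroup G) m := by
  classical
  have hodd : Odd m := odd_of_isCoprime_of_even hm (hN.card_eq ▸ even_two_mul _)
  have hm2N := hm
  rw [hN.card_eq, Nat.cast_mul] at hm2N
  have hm2 := hm2N.of_mul_right_left
  have hmN := hm2N.of_mul_right_right
  obtain ⟨k, hk⟩ := hN.odd_card
  rw [hN.dGroup_eq hk, kroneckerSym_mul_sq _ hodd, hN.sign_powPerm_eq hm hmN,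
    sign_powPerm_of_odd_card hN.odd_card, kroneckerSym_neg_one_pow_half_mul_self hN.odd_card hmN]
  · exact (hm2.pow_right.mul_right hmN.pow_right).symm
  · have := hN.odd_card.pos
    positivity

end IsOddDihedralKernel

theorem sign_powPerm_eq_kroneckerSym_of_isTwiceOddWithInvolutions [Fintype G] [DecidableEq G]
    (hG : IsTwiceOddWithInvolutions G) (m : ℤ) (hm : IsCoprime m (Nat.card G : ℤ)) :
    (sign (powPerm G m hm) : ℤ) = kroneckerSym (dGroup G) m :=
  let ⟨_, hN⟩ := hG.exists_isOddDihedralKernel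
  hN.sign_powPerm_eq_kroneckerSym hm

end TwiceOdd

theorem theorem2 (G : Type*) [Group G] [Fintype G] [DecidableEq G]
    (hG : IsOddTimesTwoGroup G ∨ IsTwiceOddWithInvolutions G)
    (m : ℤ) (hm : IsCoprime m (Nat.card G : ℤ)) :
    ((Equiv.Perm.sign (powPerm G m hm) : ℤˣ) : ℤ) = kroneckerSym (dGroup G) m :=
  hG.elim (sign_powPerm_eq_kroneckerSym_of_isOddTimesTwoGroup · m hm)
    (sign_powPerm_eq_kroneckerSym_of_isTwiceOddWithInvolutions · m hm)
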